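/- Let $\Omega$ be a compact metric space, let $\Delta(\Omega)$ be the set of Borel probability measures on $\Omega$ with the weak$^\star$ topology, and let the prior $\mu_0\in\Delta(\Omega)$ have full support. For an objective function $V:\Delta(\Omega)\to\mathbb{R}$, the primal problem is to maximize $\int_{\Delta(\Omega)}V\,\mathrm{d}\tau$ over $\tau\in\Delta(\Delta(\Omega))$ with $\int_{\Delta(\Omega)}\mu\,\mathrm{d}\tau(\mu)=\mu_0$. The dual problem is to minimize $\int_\Omega P\,\mathrm{d}\mu_0$ over $P\in C(\Omega)$ with $\int_\Omega P\,\mathrm{d}\mu\ge V(\mu)$ for all $\mu\in\Delta(\Omega)$. Strong duality holds if both problems have optimal solutions $\tau$ and $P$ and $\int_\Omega P\,\mathrm{d}\mu_0=\int_{\Delta(\Omega)}V\,\mathrm{d}\tau$. The concave closure of $V$ is $$\widehat V(\mu)=\inf\{H(\mu)\mid H:\Delta(\Omega)\to\mathbb{R},\ H\ge V,\ H\text{ affine and continuous}\}.$$ The persuasion problem is regular if there is an affine continuous $\overline V:\Delta(\Omega)\to\mathbb{R}$ with $\overline V(\mu_0)=\widehat V(\mu_0)$ and $\overline V(\mu)\ge\widehat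 V(\mu)$ for all $\mu\in\Delta(\Omega)$. Proposition. Let $m:\Omega\to\mathbb{R}^N$ be continuous, let $X$ be the convex hull of $m(\Omega)$, let $v$ be a real function that is Lipschitz continuous on $X$, and let $V(\mu)=v\left(\int_\Omega m\,\mathrm{d}\mu\right)$ for $\mu\in\Delta(\Omega)$. Then the persuasion problem is regular, and strong duality holds. In particular, for $N=2$, any continuous $m:\Omega\to\mathbb{R}^2$ and $v(x_1,x_2)=x_1x_2$ (for example, $\Omega\subset\mathbb{R}^2_+$ compact and $m(\omega)=\omega$), the persuasion problem is regular and strong duality holds. -/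

import Mathlib

open MeasureTheory
open scoped NNReal ENNReal

namespace Persuasion

noncomputable section

section Problem

variable {Ω : Type*} [MetricSpace Ω] [MeasurableSpace Ω] [BorelSpace Ω]

/-- A real function on `Δ(Ω)` is affine if it respects convex combinations of measures. -/
def IsAffine (H : ProbabilityMeasure Ω → ℝ) : Prop :=
  ∀ (μ ν η : ProbabilityMeasure Ω) (a b : ℝ≥0), a + b = 1 →
    (η : Measure Ω) = a • (μ : Measure Ω) + b • (ν : Measure Ω) →
    H η = (a : ℝ) * H μ + (b : ℝ) * H ν

/-- The affine functions that majorize `V` and are continuous for the weak* topology of `Δ(Ω)`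
(the topology of Mathlib's `ProbabilityMeasure`). -/
def affineMajorants (V : ProbabilityMeasure Ω → ℝ) : Set (ProbabilityMeasure Ω → ℝ) :=
  {H | (∀ μ, V μ ≤ H μ) ∧ IsAffine H ∧ Continuous H}

/-- The concave closure of `V`. The set of values is bounded below by `V μ`, and it is nonempty
(it contains a constant) whenever `V` is bounded above, so the infimum is a genuine one. -/
def concaveClosure (V : ProbabilityMeasure Ω → ℝ) (μ : ProbabilityMeasure Ω) : ℝ :=
  sInf ((fun H : ProbabilityMeasure Ω → ℝ => H μ) '' affineMajorants V)

/-- For an upper semicontinuous objective on a compact state space the concave closure is a genuine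
infimum. -/
theorem isGLB_concaveClosure [CompactSpace Ω] (V : ProbabilityMeasure Ω → ℝ)
    (hV : UpperSemicontinuous V) (μ : ProbabilityMeasure Ω) :
    IsGLB ((fun H : ProbabilityMeasure Ω → ℝ => H μ) '' affineMajorants V)
      (concaveClosure V μ) := by
  obtain ⟨C, hC⟩ := (hV.upperSemicontinuousOn _).bddAbove_of_isCompact
    (isCompact_univ (X := ProbabilityMeasure Ω))
  refine isGLB_csInf ⟨_, fun _ => C, ⟨fun ν => hC ⟨ν, trivial, rfl⟩, ?_, continuous_const⟩, rfl⟩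
    ⟨V μ, ?_⟩
  · intro _ _ _ a b h _
    have : (a : ℝ) + b = 1 := by exact_mod_cast h
    simp only [← add_mul, this, one_mul]
  · rintro _ ⟨H, hH, rfl⟩
    exact hH.1 μ

/-- Regularity: the concave closure of `V` is superdifferentiable at the prior `μ₀`. -/
def Regular (V : ProbabilityMeasure Ω → ℝ) (μ₀ : ProbabilityMeasure Ω) : Prop :=
  ∃ H : ProbabilityMeasure Ω → ℝ, IsAffine H ∧ Continuous H ∧
    H μ₀ = concaveClosure V μ₀ ∧ ∀ μ, concaveClosure V μ ≤ H μ

/-- `τ ∈ Δ(Δ(Ω))` is feasible for the primal problem: its barycenter is the prior.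
(The sigma-algebra on `Δ(Ω)` is generated by the evaluations `μ ↦ μ B`; for a compact metric `Ω` it
is the Borel sigma-algebra of the weak* topology.) -/
def PrimalFeasible (μ₀ : ProbabilityMeasure Ω)
    (τ : ProbabilityMeasure (ProbabilityMeasure Ω)) : Prop :=
  ∀ B : Set Ω, MeasurableSet B →
    ∫⁻ μ, (μ : Measure Ω) B ∂(τ : Measure (ProbabilityMeasure Ω)) = (μ₀ : Measure Ω) B

/-- `τ` maximizes `∫ V dτ` among the feasible distributions of posteriors. For `V` measurable and
bounded above, a `τ'` for which `V` is not integrable has value `-∞` and is no competitor. -/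
def PrimalOptimal (V : ProbabilityMeasure Ω → ℝ) (μ₀ : ProbabilityMeasure Ω)
    (τ : ProbabilityMeasure (ProbabilityMeasure Ω)) : Prop :=
  PrimalFeasible μ₀ τ ∧ Integrable V (τ : Measure (ProbabilityMeasure Ω)) ∧
    ∀ τ' : ProbabilityMeasure (ProbabilityMeasure Ω), PrimalFeasible μ₀ τ' →
      Integrable V (τ' : Measure (ProbabilityMeasure Ω)) →
      ∫ μ, V μ ∂(τ' : Measure (ProbabilityMeasure Ω)) ≤
        ∫ μ, V μ ∂(τ : Measure (ProbabilityMeasure Ω))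

/-- A price function `P ∈ C(Ω)` is feasible for the dual problem. -/
def DualFeasible (V : ProbabilityMeasure Ω → ℝ) (P : C(Ω, ℝ)) : Prop :=
  ∀ μ : ProbabilityMeasure Ω, V μ ≤ ∫ ω, P ω ∂(μ : Measure Ω)

/-- `P` minimizes `∫ P dμ₀` among the feasible price functions. -/
def DualOptimal (V : ProbabilityMeasure Ω → ℝ) (μ₀ : ProbabilityMeasure Ω) (P : C(Ω, ℝ)) : Prop :=
  DualFeasible V P ∧ ∀ Q : C(Ω, ℝ), DualFeasible V Q →
    ∫ ω, P ω ∂(μ₀ : Measure Ω) ≤ ∫ ω, Q ω ∂(μ₀ : Measure Ω)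

/-- Strong duality: both problems have optimal solutions, and these have equal values. -/
def StrongDuality (V : ProbabilityMeasure Ω → ℝ) (μ₀ : ProbabilityMeasure Ω) : Prop :=
  ∃ (τ : ProbabilityMeasure (ProbabilityMeasure Ω)) (P : C(Ω, ℝ)),
    PrimalOptimal V μ₀ τ ∧ DualOptimal V μ₀ P ∧
    ∫ ω, P ω ∂(μ₀ : Measure Ω) = ∫ μ, V μ ∂(τ : Measure (ProbabilityMeasure Ω))

/-- The moment space: the convex hull of `m(Ω)`. -/
def momentSpace {N : ℕ} (m : Ω → EuclideanSpace ℝ (Fin N)) : Set (EuclideanSpace ℝ (Fin N)) :=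
  convexHull ℝ (Set.range m)

/-- The objective function of moment persuasion, `V(μ) = v(∫ m dμ)`. -/
def momentObjective {N : ℕ} (m : Ω → EuclideanSpace ℝ (Fin N))
    (v : EuclideanSpace ℝ (Fin N) → ℝ) (μ : ProbabilityMeasure Ω) : ℝ :=
  v (∫ ω, m ω ∂(μ : Measure Ω))

end Problem

end

end Persuasion

/-! The crux is attainment in the dual. Let `V` be `L`-Lipschitz in the moments and `P` a feasible
price. The envelope `Q x = min_y (P y + L * ‖m x - m y‖)` lies below `P` and stays feasible: moving
the mass at each `x` to a minimizer `g x` changes `V` by at most `L * ∫ ‖m x - m (g x)‖`, exactly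
what `Q` charges on top of `P ∘ g`. So only prices that are `L`-Lipschitz along `m` matter. Those
with value at most `sup |V|` are uniformly bounded and equicontinuous, and Arzelà–Ascoli gives a
minimizer (`exists_dualOptimal`).

A primal optimum with the same value comes from Hahn–Banach and Riesz: the dual value is sublinear
in the objective, and a linear functional below it that agrees with it at `V` is a feasible `τ`
(`exists_primalFeasible_integral_eq`). Regularity follows because continuous affine functions on
`Δ(Ω)` are exactly the integrals of prices, so a dual optimum supports the concave closure at the
prior. The product `x₀ x₁` is Lipschitz on the compact moment space. -/

namespace Persuasion

open Filter Topology ProbabilityTheory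

/-! ### The sigma-algebra of evaluations on `Δ(Ω)` -/

section Measurability

variable {Ω : Type*} [MetricSpace Ω] [MeasurableSpace Ω] [BorelSpace Ω]

theorem measurable_coe_probabilityMeasure {Ω : Type*} [MeasurableSpace Ω] :
    Measurable fun μ : ProbabilityMeasure Ω => (μ : Measure Ω) :=
  measurable_subtype_coe

/-- The Giry sigma-algebra on `Δ(Ω)` is coarser than the weak* Borel sigma-algebra. -/
theorem measurableSpace_probabilityMeasure_le_borel :
    (inferInstance : MeasurableSpace (ProbabilityMeasure Ω)) ≤
      borel (ProbabilityMeasure Ω) := by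
  have h : @Measurable _ _ (borel (ProbabilityMeasure Ω)) _
      (fun μ : ProbabilityMeasure Ω => (μ : Measure Ω)) := by
    let _ : MeasurableSpace (ProbabilityMeasure Ω) := borel _
    have : BorelSpace (ProbabilityMeasure Ω) := ⟨rfl⟩
    -- Open sets generate, and on them evaluation is lower semicontinuous by the portmanteau
    -- theorem.
    refine Measurable.measure_of_isPiSystem_of_isProbabilityMeasure
      (BorelSpace.measurable_eq (α := Ω)) isPiSystem_isOpen fun U hU => ?_
    refine LowerSemicontinuous.measurable (lowerSemicontinuous_iff_le_liminf.2 fun μ => ?_)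
    exact ProbabilityMeasure.le_liminf_measure_open_of_tendsto tendsto_id hU
  exact measurable_iff_comap_le.1 h

theorem measurable_integral_probabilityMeasure {E : Type*} [NormedAddCommGroup E]
    [NormedSpace ℝ E] [MeasurableSpace E] [BorelSpace E] [SecondCountableTopology E]
    {f : Ω → E} (hf : Continuous f) :
    Measurable fun μ : ProbabilityMeasure Ω => ∫ x, f x ∂(μ : Measure Ω) := by
  let κ : Kernel (ProbabilityMeasure Ω) Ω := ⟨fun μ => μ, measurable_coe_probabilityMeasure⟩
  have : IsMarkovKernel κ := ⟨fun μ => inferInstanceAs (IsProbabilityMeasure (μ : Measure Ω))⟩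
  exact (StronglyMeasurable.integral_kernel (κ := κ)
    hf.measurable.stronglyMeasurable).measurable

theorem bind_eq_of_primalFeasible {Ω : Type*} [MeasurableSpace Ω] {μ₀ : ProbabilityMeasure Ω}
    {τ : ProbabilityMeasure (ProbabilityMeasure Ω)} (h : PrimalFeasible μ₀ τ) :
    (τ : Measure (ProbabilityMeasure Ω)).bind (fun μ => (μ : Measure Ω)) = μ₀ := by
  ext B hB
  rw [Measure.bind_apply hB measurable_coe_probabilityMeasure.aemeasurable]
  exact h B hB

end Measurability

/-! ### Weak limits and barycenters -/

section Approximation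

variable {Ω : Type*} [MetricSpace Ω] [CompactSpace Ω] [MeasurableSpace Ω] [BorelSpace Ω]

/-- On a compact space, `μ` is the weak limit of its images under finitely valued maps. -/
theorem exists_simpleFunc_tendsto_map (μ : ProbabilityMeasure Ω) :
    ∃ f : ℕ → SimpleFunc Ω Ω,
      Tendsto (fun n => μ.map (f n).measurable.aemeasurable) atTop (𝓝 μ) := by
  obtain ⟨x₀⟩ := μ.nonempty
  refine ⟨SimpleFunc.approxOn id measurable_id Set.univ x₀ (Set.mem_univ _), ?_⟩
  rw [ProbabilityMeasure.tendsto_iff_forall_integral_tendsto]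
  intro g
  have hmap : ∀ n, ∫ x, g x ∂(μ.map (SimpleFunc.approxOn id measurable_id Set.univ x₀
      (Set.mem_univ _) n).measurable.aemeasurable : Measure Ω) =
      ∫ x, g (SimpleFunc.approxOn id measurable_id Set.univ x₀ (Set.mem_univ _) n x)
        ∂(μ : Measure Ω) := fun n => by
    rw [ProbabilityMeasure.toMeasure_map]
    exact integral_map (SimpleFunc.measurable _).aemeasurable
      g.continuous.measurable.aestronglyMeasurable
  simp_rw [hmap]
  refine tendsto_integral_of_dominated_convergence (fun _ => ‖g‖) (fun n => ?_)
    (integrable_const _) (fun n => Eventually.of_forall fun x => g.norm_coe_le_norm _)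
    (Eventually.of_forall fun x => ?_)
  · exact (g.continuous.measurable.comp (SimpleFunc.measurable _)).aestronglyMeasurable
  · exact (g.continuous.tendsto x).comp
      (SimpleFunc.tendsto_approxOn measurable_id (Set.mem_univ _) (by simp))

theorem _root_.Continuous.integrable_probabilityMeasure {E : Type*} [NormedAddCommGroup E]
    [SecondCountableTopology E] {f : Ω → E} (hf : Continuous f) (μ : ProbabilityMeasure Ω) :
    Integrable f (μ : Measure Ω) := by
  borelize E
  exact (BoundedContinuousFunction.mkOfCompact ⟨f, hf⟩).integrable _

theorem continuous_integral_euclidean {N : ℕ} {m : Ω → EuclideanSpace ℝ (Fin N)}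
    (hm : Continuous m) :
    Continuous fun μ : ProbabilityMeasure Ω => ∫ x, m x ∂(μ : Measure Ω) := by
  have h : Continuous fun (μ : ProbabilityMeasure Ω) (i : Fin N) =>
      ∫ x, m x i ∂(μ : Measure Ω) := continuous_pi fun i =>
    ProbabilityMeasure.continuous_integral_continuousMap
      (⟨fun x => m x i, by fun_prop⟩ : C(Ω, ℝ))
  refine ((PiLp.continuous_toLp 2 _).comp h).congr fun μ => ?_
  ext i
  exact (EuclideanSpace.proj (𝕜 := ℝ) i).integral_comp_comm (hm.integrable_probabilityMeasure μ)

theorem integral_bind_probabilityMeasure (τ : ProbabilityMeasure (ProbabilityMeasure Ω))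
    (P : C(Ω, ℝ)) :
    ∫ x, P x ∂((τ : Measure (ProbabilityMeasure Ω)).bind (fun μ => (μ : Measure Ω))) =
      ∫ μ, ∫ x, P x ∂(μ : Measure Ω) ∂(τ : Measure (ProbabilityMeasure Ω)) := by
  let κ : Kernel (ProbabilityMeasure Ω) Ω := ⟨fun μ => μ, measurable_coe_probabilityMeasure⟩
  have : IsMarkovKernel κ := ⟨fun μ => inferInstanceAs (IsProbabilityMeasure (μ : Measure Ω))⟩
  have := Kernel.integral_comp (κ := Kernel.const Unit (τ : Measure (ProbabilityMeasure Ω)))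
    (η := κ) (a := ()) (f := P) ((BoundedContinuousFunction.mkOfCompact P).integrable _)
  simpa [Kernel.comp_apply] using! this

theorem integral_integral_of_primalFeasible {μ₀ : ProbabilityMeasure Ω}
    {τ : ProbabilityMeasure (ProbabilityMeasure Ω)} (h : PrimalFeasible μ₀ τ) (P : C(Ω, ℝ)) :
    ∫ μ, ∫ x, P x ∂(μ : Measure Ω) ∂(τ : Measure (ProbabilityMeasure Ω)) =
      ∫ x, P x ∂(μ₀ : Measure Ω) := by
  rw [← integral_bind_probabilityMeasure, bind_eq_of_primalFeasible h]

/-- A finite Borel measure on `Ω` is determined by its integrals of continuous functions. -/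
theorem primalFeasible_of_integral_eq {μ₀ : ProbabilityMeasure Ω}
    {τ : ProbabilityMeasure (ProbabilityMeasure Ω)}
    (h : ∀ P : C(Ω, ℝ), ∫ μ, ∫ x, P x ∂(μ : Measure Ω) ∂(τ : Measure (ProbabilityMeasure Ω)) =
      ∫ x, P x ∂(μ₀ : Measure Ω)) : PrimalFeasible μ₀ τ := by
  have hprob : IsProbabilityMeasure
      ((τ : Measure (ProbabilityMeasure Ω)).bind (fun μ => (μ : Measure Ω))) :=
    isProbabilityMeasure_bind measurable_coe_probabilityMeasure.aemeasurable
      (Eventually.of_forall fun μ => inferInstance)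
  have heq : (τ : Measure (ProbabilityMeasure Ω)).bind (fun μ => (μ : Measure Ω)) = μ₀ :=
    ext_of_forall_integral_eq_of_IsFiniteMeasure fun f => by
      simpa using! (integral_bind_probabilityMeasure τ f.toContinuousMap).trans
        (h f.toContinuousMap)
  intro B hB
  rw [← heq, Measure.bind_apply hB measurable_coe_probabilityMeasure.aemeasurable]

/-- Continuity gives the bound, by compactness of `Δ(Ω)`. Measurability is a separate hypothesis
because only one inclusion between the evaluation and Borel sigma-algebras has been established. -/
theorem integrable_of_continuous_of_measurable {V : ProbabilityMeasure Ω → ℝ} (hV : Measurable V)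
    (hc : Continuous V) (τ : ProbabilityMeasure (ProbabilityMeasure Ω)) :
    Integrable V (τ : Measure (ProbabilityMeasure Ω)) :=
  Integrable.of_bound hV.aestronglyMeasurable ‖ContinuousMap.mk V hc‖
    (Eventually.of_forall fun μ => (ContinuousMap.mk V hc).norm_coe_le_norm μ)

end Approximation

/-! ### Continuous affine functions as integrals -/

section Affine

variable {Ω : Type*} [MetricSpace Ω] [MeasurableSpace Ω] [BorelSpace Ω]

/-- Peel off one atom at a time: `ν` is a convex combination of `δ_a` and `ν` conditioned on `{a}ᶜ`.
The cases `ν {a} = 0` and `ν {a}ᶜ = 0` are treated apart. -/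
theorem IsAffine.eq_integral_of_finite_support {H : ProbabilityMeasure Ω → ℝ} (hH : IsAffine H)
    (s : Finset Ω) : ∀ ν : ProbabilityMeasure Ω, (ν : Measure Ω) (s : Set Ω)ᶜ = 0 →
      H ν = ∫ x, H (diracProba x) ∂(ν : Measure Ω) := by
  classical
  induction s using Finset.induction_on with
  | empty => intro ν h; simp at h
  | insert a s ha ih =>
    intro ν hν
    by_cases h0 : (ν : Measure Ω) {a} = 0
    · refine ih ν (measure_mono_null (t := ((insert a s : Finset Ω) : Set Ω)ᶜ ∪ {a}) ?_
        (measure_union_null hν h0))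
      intro x hx
      by_cases hxa : x = a <;> simp_all
    by_cases h1 : (ν : Measure Ω) {a}ᶜ = 0
    · have hd : ν = diracProba a := by
        apply Subtype.ext
        change (ν : Measure Ω) = Measure.dirac a
        have hp : (ν : Measure Ω) {a} = 1 := by
          rwa [← prob_compl_eq_zero_iff (MeasurableSet.singleton a)]
        have hr := Measure.restrict_eq_self_of_ae_mem (μ := (ν : Measure Ω)) (s := {a})
          (mem_ae_iff.2 h1)
        rw [← hr, Measure.restrict_singleton, hp, one_smul]
      rw [hd]
      change _ = ∫ x, H (diracProba x) ∂(Measure.dirac a)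
      rw [integral_dirac]
    · have hprob : IsProbabilityMeasure (ν : Measure Ω)[|{a}ᶜ] := cond_isProbabilityMeasure h1
      let ν' : ProbabilityMeasure Ω := ⟨(ν : Measure Ω)[|{a}ᶜ], hprob⟩
      have hν' : (ν' : Measure Ω) (s : Set Ω)ᶜ = 0 := by
        change (ν : Measure Ω)[|{a}ᶜ] (s : Set Ω)ᶜ = 0
        rw [cond_apply (MeasurableSet.singleton a).compl]
        have : ({a}ᶜ : Set Ω) ∩ (s : Set Ω)ᶜ = ((insert a s : Finset Ω) : Set Ω)ᶜ := by
          ext x; simp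
        rw [this, hν, mul_zero]
      have hsum : ν {a} + ν {a}ᶜ = 1 := by
        have := prob_add_prob_compl (μ := (ν : Measure Ω)) (MeasurableSet.singleton a)
        rw [← ProbabilityMeasure.ennreal_coeFn_eq_coeFn_toMeasure,
          ← ProbabilityMeasure.ennreal_coeFn_eq_coeFn_toMeasure] at this
        exact_mod_cast this
      have hdecomp : (ν : Measure Ω) =
          ν {a} • ((diracProba a : ProbabilityMeasure Ω) : Measure Ω) +
            ν {a}ᶜ • (ν' : Measure Ω) := by
        have e1 : ν {a} • ((diracProba a : ProbabilityMeasure Ω) : Measure Ω) =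
            (ν : Measure Ω).restrict {a} := by
          rw [Measure.restrict_singleton,
            ← ProbabilityMeasure.ennreal_coeFn_eq_coeFn_toMeasure]
          rfl
        have e2 : ν {a}ᶜ • (ν' : Measure Ω) = (ν : Measure Ω).restrict {a}ᶜ := by
          change ν {a}ᶜ • (((ν : Measure Ω) {a}ᶜ)⁻¹ • (ν : Measure Ω).restrict {a}ᶜ) = _
          have : ∀ ξ : Measure Ω, ν {a}ᶜ • ξ = ((ν {a}ᶜ : ℝ≥0) : ℝ≥0∞) • ξ := fun _ => rfl
          rw [this, ProbabilityMeasure.ennreal_coeFn_eq_coeFn_toMeasure, smul_smul,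
            ENNReal.mul_inv_cancel h1 (measure_ne_top _ _), one_smul]
        rw [e1, e2, Measure.restrict_add_restrict_compl (MeasurableSet.singleton a)]
      have hint : ∀ (ξ : ProbabilityMeasure Ω) (t : Finset Ω), (ξ : Measure Ω) (t : Set Ω)ᶜ = 0 →
          Integrable (fun x => H (diracProba x)) (ξ : Measure Ω) := by
        intro ξ t ht
        rw [← Measure.restrict_eq_self_of_ae_mem (μ := (ξ : Measure Ω)) (s := (t : Set Ω))
          (mem_ae_iff.2 ht)]
        exact IntegrableOn.finset
      rw [hH (diracProba a) ν' ν _ _ hsum hdecomp, ih ν' hν']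
      conv_rhs => rw [hdecomp]
      rw [integral_add_measure, integral_smul_nnreal_measure, integral_smul_nnreal_measure]
      · congr 1
        change _ = ν {a} • ∫ x, H (diracProba x) ∂(Measure.dirac a)
        rw [integral_dirac]
        rfl
      · refine Integrable.smul_measure_nnreal (hint _ {a} ?_)
        rw [diracProba_toMeasure_apply]
        simp
      · exact (hint ν' s hν').smul_measure_nnreal

/-- A continuous affine function on `Δ(Ω)` integrates its values at point masses. -/
theorem IsAffine.eq_integral [CompactSpace Ω] {H : ProbabilityMeasure Ω → ℝ} (hH : IsAffine H)
    (hc : Continuous H) (μ : ProbabilityMeasure Ω) :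
    H μ = ∫ x, H (diracProba x) ∂(μ : Measure Ω) := by
  obtain ⟨f, hf⟩ := exists_simpleFunc_tendsto_map μ
  let P : C(Ω, ℝ) := ⟨fun x => H (diracProba x), hc.comp continuous_diracProba⟩
  have h2 := ((ProbabilityMeasure.continuous_integral_continuousMap P).tendsto μ).comp hf
  refine tendsto_nhds_unique ((hc.tendsto μ).comp hf) (h2.congr fun n => ?_)
  refine (hH.eq_integral_of_finite_support (f n).range _ ?_).symm
  rw [ProbabilityMeasure.map_apply' _ _ (Finset.measurableSet _).compl]
  convert measure_empty (μ := (μ : Measure Ω))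
  ext x
  simp

theorem isAffine_integral [CompactSpace Ω] (P : C(Ω, ℝ)) :
    IsAffine fun μ : ProbabilityMeasure Ω => ∫ x, P x ∂(μ : Measure Ω) := by
  intro μ ν η a b _ h
  have hP := P.continuous.integrable_probabilityMeasure
  simp only [h]
  rw [integral_add_measure (hP μ).smul_measure_nnreal (hP ν).smul_measure_nnreal,
    integral_smul_nnreal_measure, integral_smul_nnreal_measure]
  rfl

end Affine

/-! ### Positive functionals as probability measures -/

section Riesz

variable {X : Type*} [TopologicalSpace X] [T2Space X] [CompactSpace X]

/-- A normalized positive functional on `C(X, ℝ)` is a Borel probability measure. -/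
theorem exists_probabilityMeasure_of_positive [MeasurableSpace X] [BorelSpace X]
    (Λ : C(X, ℝ) →ₗ[ℝ] ℝ) (hpos : ∀ f, 0 ≤ f → 0 ≤ Λ f) (hone : Λ 1 = 1) :
    ∃ τ : ProbabilityMeasure X, ∀ f : C(X, ℝ), ∫ x, f x ∂(τ : Measure X) = Λ f := by
  let Λ' : CompactlySupportedContinuousMap X ℝ →ₚ[ℝ] ℝ :=
    { toFun := fun f => Λ f.toContinuousMap
      map_add' := fun f g => Λ.map_add f.toContinuousMap g.toContinuousMap
      map_smul' := fun c f => Λ.map_smul c f.toContinuousMap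
      monotone' := fun f g hfg => by
        have := hpos (g.toContinuousMap - f.toContinuousMap)
          (fun x => sub_nonneg.2 (hfg x))
        rwa [map_sub, sub_nonneg] at this }
  have hint : ∀ f : C(X, ℝ), ∫ x, f x ∂(RealRMK.rieszMeasure Λ') = Λ f := fun f =>
    RealRMK.integral_rieszMeasure Λ' ⟨f, HasCompactSupport.of_compactSpace f⟩
  have h1 : (RealRMK.rieszMeasure Λ').real Set.univ = 1 := by
    have := hint 1
    simpa [hone] using this
  have hprob : IsProbabilityMeasure (RealRMK.rieszMeasure Λ') := by
    constructor
    rw [measureReal_def] at h1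
    rwa [ENNReal.toReal_eq_one_iff] at h1
  exact ⟨⟨_, hprob⟩, hint⟩

/-- The representing measure restricted to a sigma-algebra coarser than the Borel one. -/
theorem exists_probabilityMeasure_of_positive_of_le_borel [mX : MeasurableSpace X]
    (hm : mX ≤ borel X)
    (Λ : C(X, ℝ) →ₗ[ℝ] ℝ) (hpos : ∀ f, 0 ≤ f → 0 ≤ Λ f) (hone : Λ 1 = 1) :
    ∃ τ : ProbabilityMeasure X, ∀ f : C(X, ℝ), Measurable f →
      ∫ x, f x ∂(τ : Measure X) = Λ f := by
  obtain ⟨τ, hτ⟩ := @exists_probabilityMeasure_of_positive X _ _ _ (borel X)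
    (@BorelSpace.mk X _ (borel X) rfl) Λ hpos hone
  have hprob : IsProbabilityMeasure (τ.1.trim hm) :=
    ⟨(trim_measurableSet_eq hm MeasurableSet.univ).trans τ.2.measure_univ⟩
  refine ⟨⟨τ.1.trim hm, hprob⟩, fun f hf => ?_⟩
  exact (integral_trim hm hf.stronglyMeasurable).symm.trans (hτ f)

end Riesz

/-! ### Sublinearity of the dual value and absence of a duality gap -/

section DualValues

variable {Ω : Type*} [MetricSpace Ω] [MeasurableSpace Ω]

/-- The values of the feasible price functions of the dual problem. -/
def dualValues (μ₀ : ProbabilityMeasure Ω) (V : ProbabilityMeasure Ω → ℝ) : Set ℝ :=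
  (fun P : C(Ω, ℝ) => ∫ x, P x ∂(μ₀ : Measure Ω)) '' {P | DualFeasible V P}

theorem dualFeasible_const {V : ProbabilityMeasure Ω → ℝ} {c : ℝ} (h : ∀ μ, V μ ≤ c) :
    DualFeasible V (ContinuousMap.const Ω c) := fun μ => by simpa using h μ

theorem dualFeasible_smul {V : ProbabilityMeasure Ω → ℝ} {P : C(Ω, ℝ)} {c : ℝ} (hc : 0 ≤ c)
    (hP : DualFeasible V P) : DualFeasible (c • V) (c • P) := fun μ => by
  simp only [ContinuousMap.smul_apply, Pi.smul_apply, smul_eq_mul, integral_const_mul]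
  exact mul_le_mul_of_nonneg_left (hP μ) hc

theorem bddBelow_dualValues (μ₀ : ProbabilityMeasure Ω) (V : ProbabilityMeasure Ω → ℝ) :
    BddBelow (dualValues μ₀ V) :=
  ⟨V μ₀, by rintro _ ⟨P, hP, rfl⟩; exact hP μ₀⟩

theorem sInf_dualValues_le {μ₀ : ProbabilityMeasure Ω} {V : ProbabilityMeasure Ω → ℝ}
    {P : C(Ω, ℝ)} (hP : DualFeasible V P) :
    sInf (dualValues μ₀ V) ≤ ∫ x, P x ∂(μ₀ : Measure Ω) :=
  csInf_le (bddBelow_dualValues μ₀ V) ⟨P, hP, rfl⟩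

end DualValues

section Duality

variable {Ω : Type*} [MetricSpace Ω] [CompactSpace Ω] [MeasurableSpace Ω] [BorelSpace Ω]

/-- The continuous function `μ ↦ ∫ P dμ` on `Δ(Ω)`. -/
noncomputable def expectation (P : C(Ω, ℝ)) : C(ProbabilityMeasure Ω, ℝ) :=
  ⟨fun μ => ∫ x, P x ∂(μ : Measure Ω), ProbabilityMeasure.continuous_integral_continuousMap P⟩

theorem dualFeasible_add {V W : ProbabilityMeasure Ω → ℝ} {P Q : C(Ω, ℝ)}
    (hP : DualFeasible V P) (hQ : DualFeasible W Q) : DualFeasible (V + W) (P + Q) := fun μ => by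
  have := integral_add (P.continuous.integrable_probabilityMeasure μ)
    (Q.continuous.integrable_probabilityMeasure μ)
  simp only [ContinuousMap.add_apply, Pi.add_apply, this]
  exact add_le_add (hP μ) (hQ μ)

theorem dualValues_nonempty (μ₀ : ProbabilityMeasure Ω) (V : C(ProbabilityMeasure Ω, ℝ)) :
    (dualValues μ₀ V).Nonempty :=
  Set.Nonempty.image _ ⟨_, dualFeasible_const fun μ =>
    (le_abs_self _).trans (V.norm_coe_le_norm μ)⟩

theorem sInf_dualValues_add_le (μ₀ : ProbabilityMeasure Ω) (V W : C(ProbabilityMeasure Ω, ℝ)) :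
    sInf (dualValues μ₀ (V + W : C(ProbabilityMeasure Ω, ℝ))) ≤
      sInf (dualValues μ₀ V) + sInf (dualValues μ₀ W) := by
  rw [← sub_le_iff_le_add]
  refine le_csInf (dualValues_nonempty μ₀ V) ?_
  rintro _ ⟨P, hP, rfl⟩
  rw [sub_le_comm]
  refine le_csInf (dualValues_nonempty μ₀ W) ?_
  rintro _ ⟨Q, hQ, rfl⟩
  rw [sub_le_iff_le_add']
  refine (sInf_dualValues_le (dualFeasible_add hP hQ)).trans_eq ?_
  exact integral_add (P.continuous.integrable_probabilityMeasure μ₀)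
    (Q.continuous.integrable_probabilityMeasure μ₀)

theorem sInf_dualValues_smul_le (μ₀ : ProbabilityMeasure Ω) (V : C(ProbabilityMeasure Ω, ℝ))
    {c : ℝ} (hc : 0 < c) :
    sInf (dualValues μ₀ (c • V : C(ProbabilityMeasure Ω, ℝ))) ≤ c * sInf (dualValues μ₀ V) := by
  rw [← div_le_iff₀' hc]
  refine le_csInf (dualValues_nonempty μ₀ V) ?_
  rintro _ ⟨P, hP, rfl⟩
  rw [div_le_iff₀' hc]
  refine (sInf_dualValues_le (dualFeasible_smul hc.le hP)).trans_eq ?_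
  exact integral_const_mul _ _

theorem sInf_dualValues_smul (μ₀ : ProbabilityMeasure Ω) {c : ℝ} (hc : 0 < c)
    (V : C(ProbabilityMeasure Ω, ℝ)) :
    sInf (dualValues μ₀ (c • V : C(ProbabilityMeasure Ω, ℝ))) = c * sInf (dualValues μ₀ V) := by
  refine le_antisymm (sInf_dualValues_smul_le μ₀ V hc) ?_
  -- The reverse inequality is the same bound for the factor `c⁻¹`.
  have := sInf_dualValues_smul_le μ₀ (c • V) (inv_pos.2 hc)
  rwa [smul_smul, inv_mul_cancel₀ hc.ne', one_smul, inv_mul_eq_div, le_div_iff₀' hc] at this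

/-- There is no duality gap: for a continuous objective, some feasible distribution of posteriors
attains the infimum of the dual problem. -/
theorem exists_primalFeasible_integral_eq (μ₀ : ProbabilityMeasure Ω)
    (V : C(ProbabilityMeasure Ω, ℝ)) (hV : Measurable V) :
    ∃ τ : ProbabilityMeasure (ProbabilityMeasure Ω), PrimalFeasible μ₀ τ ∧
      ∫ μ, V μ ∂(τ : Measure (ProbabilityMeasure Ω)) = sInf (dualValues μ₀ V) := by
  set p : C(ProbabilityMeasure Ω, ℝ) → ℝ := fun f => sInf (dualValues μ₀ f)
  have p_add : ∀ f g, p (f + g) ≤ p f + p g := sInf_dualValues_add_le μ₀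
  have p_smul : ∀ c : ℝ, 0 < c → ∀ f, p (c • f) = c * p f := fun c hc f =>
    sInf_dualValues_smul μ₀ hc f
  have p_zero : p 0 = 0 := by
    have := p_smul 2 two_pos 0
    rw [smul_zero] at this
    linarith
  have hwd : ∀ c : ℝ, c • V = 0 → (RingHom.id ℝ) c • p V = 0 := by
    intro c hc
    rcases smul_eq_zero.1 hc with h | h
    · simp [h]
    · simp [h, p_zero]
  obtain ⟨Λ, hΛV, hΛp⟩ := exists_extension_of_le_sublinear
    (LinearPMap.mkSpanSingleton' V (p V) hwd) p p_smul p_add (by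
      rintro ⟨f, hf⟩
      obtain ⟨c, rfl⟩ := Submodule.mem_span_singleton.1 hf
      rw [LinearPMap.mkSpanSingleton'_apply]
      change c * p V ≤ p (c • V)
      rcases lt_trichotomy c 0 with hc | rfl | hc
      -- Subadditivity gives `0 = p 0 ≤ p (c • V) + p (-c • V)`.
      · have h1 := p_smul (-c) (neg_pos.2 hc) V
        have h2 := p_add (c • V) (-c • V)
        rw [← add_smul, add_neg_cancel, zero_smul, p_zero, h1] at h2
        linarith
      · simp [p_zero]
      · exact (p_smul c hc V).ge)
  have hΛV' : Λ V = p V := (hΛV ⟨V, Submodule.mem_span_singleton_self V⟩).trans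
    (LinearPMap.mkSpanSingleton'_apply_self V (p V) hwd _)
  -- `P` is a feasible price for the objective `expectation P`. Applied also to `-P`, this forces
  -- equality, which is the barycenter condition.
  have hle : ∀ P : C(Ω, ℝ), Λ (expectation P) ≤ ∫ x, P x ∂(μ₀ : Measure Ω) := fun P =>
    (hΛp _).trans (sInf_dualValues_le fun _ => le_rfl)
  have hneg : ∀ P : C(Ω, ℝ), expectation (-P) = -expectation P := fun P => by
    ext μ; exact integral_neg _
  have heq : ∀ P : C(Ω, ℝ), Λ (expectation P) = ∫ x, P x ∂(μ₀ : Measure Ω) := fun P => by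
    refine le_antisymm (hle P) ?_
    have := hle (-P)
    rw [hneg, map_neg] at this
    have h2 : ∫ x, (-P) x ∂(μ₀ : Measure Ω) = -∫ x, P x ∂(μ₀ : Measure Ω) := integral_neg _
    linarith
  have hone : Λ 1 = 1 := by
    have h1 : expectation (1 : C(Ω, ℝ)) = 1 := by ext μ; simp [expectation]
    rw [← h1, heq]; simp
  have hpos : ∀ f, 0 ≤ f → 0 ≤ Λ f := fun f hf => by
    -- For `f ≥ 0` the zero price is feasible for `-f`.
    have h1 : p (-f) ≤ ∫ x, (0 : C(Ω, ℝ)) x ∂(μ₀ : Measure Ω) :=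
      sInf_dualValues_le fun μ => by simpa using hf μ
    have h2 := hΛp (-f)
    simp only [map_neg, ContinuousMap.zero_apply, integral_zero] at h1 h2
    linarith
  obtain ⟨τ, hτ⟩ := exists_probabilityMeasure_of_positive_of_le_borel
    measurableSpace_probabilityMeasure_le_borel Λ hpos hone
  refine ⟨τ, primalFeasible_of_integral_eq fun P => ?_, (hτ V hV).trans hΛV'⟩
  exact (hτ (expectation P) (measurable_integral_probabilityMeasure P.continuous)).trans (heq P)

/-- Strong duality reduces to attainment in the dual problem. -/
theorem strongDuality_of_dualOptimal {μ₀ : ProbabilityMeasure Ω} {V : ProbabilityMeasure Ω → ℝ}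
    (hc : Continuous V) (hV : Measurable V) {P : C(Ω, ℝ)} (hP : DualOptimal V μ₀ P) :
    StrongDuality V μ₀ := by
  obtain ⟨τ, hτ, hval⟩ := exists_primalFeasible_integral_eq μ₀ ⟨V, hc⟩ hV
  have hmin : sInf (dualValues μ₀ V) = ∫ x, P x ∂(μ₀ : Measure Ω) :=
    le_antisymm (sInf_dualValues_le hP.1) (le_csInf (dualValues_nonempty μ₀ ⟨V, hc⟩)
      (by rintro _ ⟨Q, hQ, rfl⟩; exact hP.2 Q hQ))
  have hval' : ∫ μ, V μ ∂(τ : Measure (ProbabilityMeasure Ω)) = ∫ x, P x ∂(μ₀ : Measure Ω) :=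
    hval.trans hmin
  refine ⟨τ, P, ⟨hτ, integrable_of_continuous_of_measurable hV hc τ, fun τ' hτ' hint => ?_⟩, hP,
    hval'.symm⟩
  -- Weak duality: integrate `V μ ≤ ∫ P dμ` against `τ'`.
  rw [hval', ← integral_integral_of_primalFeasible hτ' P]
  exact integral_mono hint (integrable_of_continuous_of_measurable
    (measurable_integral_probabilityMeasure P.continuous) (expectation P).continuous τ') hP.1

/-- Regularity follows from attainment in the dual problem. -/
theorem regular_of_dualOptimal {μ₀ : ProbabilityMeasure Ω} {V : ProbabilityMeasure Ω → ℝ}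
    {P : C(Ω, ℝ)} (hP : DualOptimal V μ₀ P) : Regular V μ₀ := by
  have hmem : ⇑(expectation P) ∈ affineMajorants V :=
    ⟨hP.1, isAffine_integral P, (expectation P).continuous⟩
  have hle : ∀ μ, concaveClosure V μ ≤ expectation P μ := fun μ =>
    csInf_le ⟨V μ, by rintro _ ⟨H, hH, rfl⟩; exact hH.1 μ⟩ ⟨_, hmem, rfl⟩
  refine ⟨expectation P, hmem.2.1, hmem.2.2, le_antisymm ?_ (hle μ₀), hle⟩
  refine le_csInf ⟨_, _, hmem, rfl⟩ ?_
  rintro _ ⟨H, ⟨hHV, hHa, hHc⟩, rfl⟩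
  have hH := hHa.eq_integral hHc
  -- Restricting an affine majorant to point masses yields a feasible price with the same value.
  refine (hP.2 ⟨fun x => H (diracProba x), hHc.comp continuous_diracProba⟩ fun μ => ?_).trans_eq
    (hH μ₀).symm
  exact (hHV μ).trans_eq (hH μ)

end Duality

/-! ### Lipschitz envelopes and dual attainment -/

section Attainment

variable {Ω : Type*} [MetricSpace Ω] [CompactSpace Ω]

/-- The lower `L`-Lipschitz envelope of `P` along `m`; the infimum is attained. -/
theorem exists_lipschitzEnvelope {E : Type*} [SeminormedAddCommGroup E] {m : Ω → E}
    (hm : Continuous m) (L : ℝ≥0) (P : C(Ω, ℝ)) :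
    ∃ Q : C(Ω, ℝ), Q ≤ P ∧ (∀ x y, Q x ≤ Q y + L * ‖m x - m y‖) ∧
      ∀ x, ∃ y, Q x = P y + L * ‖m x - m y‖ := by
  have hex : ∀ x, ∃ y, ∀ z, P y + L * ‖m x - m y‖ ≤ P z + L * ‖m x - m z‖ := fun x => by
    obtain ⟨y, -, hy⟩ := isCompact_univ.exists_isMinOn ⟨x, Set.mem_univ x⟩
      (f := fun y => P y + L * ‖m x - m y‖) (by fun_prop)
    exact ⟨y, fun z => hy (Set.mem_univ z)⟩
  choose g hg using hex
  have hlip : ∀ x y, P (g x) + L * ‖m x - m (g x)‖ ≤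
      P (g y) + L * ‖m y - m (g y)‖ + L * ‖m x - m y‖ := fun x y => by
    have h1 := hg x (g y)
    have h2 := mul_le_mul_of_nonneg_left
      (norm_sub_le_norm_sub_add_norm_sub (m x) (m y) (m (g y))) L.coe_nonneg
    linarith
  have hcont : Continuous fun x => P (g x) + L * ‖m x - m (g x)‖ := by
    rw [continuous_iff_continuousAt]
    intro x
    have hz : Tendsto (fun y => (L : ℝ) * ‖m y - m x‖) (𝓝 x) (𝓝 0) := by
      have : Continuous fun y => (L : ℝ) * ‖m y - m x‖ := by fun_prop
      simpa using this.tendsto x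
    refine tendsto_iff_dist_tendsto_zero.2 (squeeze_zero (fun _ => dist_nonneg) (fun y => ?_) hz)
    rw [Real.dist_eq, abs_le]
    have h1 := hlip x y
    have h2 := hlip y x
    rw [norm_sub_rev (m x) (m y)] at h1
    constructor <;> linarith
  exact ⟨⟨_, hcont⟩, fun x => by simpa using hg x x, hlip, fun x => ⟨g x, rfl⟩⟩

variable [MeasurableSpace Ω] [BorelSpace Ω] {E : Type*} [NormedAddCommGroup E]
  [NormedSpace ℝ E] [SecondCountableTopology E]

theorem integral_map_simpleFunc (μ : ProbabilityMeasure Ω) {f : Ω → E} (hf : Continuous f)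
    (s : SimpleFunc Ω Ω) :
    Integrable (fun x => f (s x)) (μ : Measure Ω) ∧
      ∫ x, f x ∂(μ.map s.measurable.aemeasurable : Measure Ω) =
        ∫ x, f (s x) ∂(μ : Measure Ω) := by
  borelize E
  have hi := hf.integrable_probabilityMeasure (μ.map s.measurable.aemeasurable)
  exact ⟨(integrable_map_measure hf.aestronglyMeasurable s.measurable.aemeasurable).1 hi,
    integral_map s.measurable.aemeasurable hf.aestronglyMeasurable⟩

/-- If the objective is `L`-Lipschitz in the moments, passing to the `L`-Lipschitz envelope
preserves dual feasibility. -/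
theorem dualFeasible_of_envelope {m : Ω → E} (hm : Continuous m) {L : ℝ≥0}
    {V : ProbabilityMeasure Ω → ℝ} (hV : Continuous V)
    (hL : ∀ μ ν : ProbabilityMeasure Ω,
      V μ ≤ V ν + L * ‖∫ x, m x ∂(μ : Measure Ω) - ∫ x, m x ∂(ν : Measure Ω)‖)
    {P Q : C(Ω, ℝ)} (hP : DualFeasible V P)
    (hQ : ∀ x, ∃ y, Q x = P y + L * ‖m x - m y‖) : DualFeasible V Q := by
  choose g hg using hQ
  intro μ
  obtain ⟨f, hf⟩ := exists_simpleFunc_tendsto_map μ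
  refine le_of_tendsto_of_tendsto' ((hV.tendsto μ).comp hf)
    (((ProbabilityMeasure.continuous_integral_continuousMap Q).tendsto μ).comp hf) fun n => ?_
  -- The selection `g` need not be measurable. Composed with a finitely valued map it is, which is
  -- why `μ` is first replaced by its finitely supported approximations.
  let h : SimpleFunc Ω Ω := (f n).map g
  have hmf := integral_map_simpleFunc μ hm (f n)
  have hmh := integral_map_simpleFunc μ hm h
  have hPh := integral_map_simpleFunc μ P.continuous h
  calc V (μ.map (f n).measurable.aemeasurable)
      ≤ V (μ.map h.measurable.aemeasurable) +
          L * ‖∫ x, m x ∂(μ.map (f n).measurable.aemeasurable : Measure Ω) -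
            ∫ x, m x ∂(μ.map h.measurable.aemeasurable : Measure Ω)‖ := hL _ _
    _ ≤ ∫ x, P (h x) ∂(μ : Measure Ω) + L * ∫ x, ‖m (f n x) - m (h x)‖ ∂(μ : Measure Ω) := by
        rw [hmf.2, hmh.2, ← integral_sub hmf.1 hmh.1, ← hPh.2]
        gcongr
        · exact hP _
        · exact norm_integral_le_integral_norm _
    _ = ∫ x, Q (f n x) ∂(μ : Measure Ω) := by
        have hint : Integrable (fun x => (L : ℝ) * ‖m (f n x) - m (h x)‖) (μ : Measure Ω) :=
          (hmf.1.sub hmh.1).norm.const_mul _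
        rw [← integral_const_mul, ← integral_add hPh.1 hint]
        exact integral_congr_ae (Eventually.of_forall fun x => (hg (f n x)).symm)
    _ = _ := (integral_map_simpleFunc μ Q.continuous (f n)).2.symm

omit [MeasurableSpace Ω] [BorelSpace Ω] [NormedSpace ℝ E] [SecondCountableTopology E] in
/-- The functions in a bounded closed set that are `L`-Lipschitz along `m` form a compact set. -/
theorem isCompact_of_lipschitz_along {m : Ω → E} (hm : Continuous m) (L : ℝ≥0) (C : ℝ)
    {K : Set C(Ω, ℝ)} (hK : IsClosed K) (hlip : ∀ P ∈ K, ∀ x y, P x ≤ P y + L * ‖m x - m y‖)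
    (hb : ∀ P ∈ K, ∀ x, |P x| ≤ C) : IsCompact K := by
  let e := ContinuousMap.isometryEquivBoundedOfCompact Ω ℝ
  have himg : IsCompact (e '' K) := by
    refine BoundedContinuousFunction.arzela_ascoli₂ (Set.Icc (-C) C) isCompact_Icc _
      (e.toHomeomorph.isClosedMap _ hK) ?_ ?_
    · rintro _ x ⟨P, hP, rfl⟩
      exact abs_le.1 (hb P hP x)
    · intro x
      rw [Metric.equicontinuousAt_iff_right]
      intro ε hε
      have hz : Tendsto (fun y => (L : ℝ) * ‖m x - m y‖) (𝓝 x) (𝓝 0) := by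
        have : Continuous fun y => (L : ℝ) * ‖m x - m y‖ := by fun_prop
        simpa using this.tendsto x
      filter_upwards [hz.eventually_lt_const hε] with y hy
      rintro ⟨_, P, hP, rfl⟩
      change dist (P x) (P y) < ε
      rw [Real.dist_eq, abs_lt]
      have h1 := hlip P hP x y
      have h2 := hlip P hP y x
      rw [norm_sub_rev] at h2
      constructor <;> linarith
  simpa using! e.toHomeomorph.isCompact_image.1 himg

theorem continuous_integral_continuousMap_left (μ : ProbabilityMeasure Ω) :
    Continuous fun P : C(Ω, ℝ) => ∫ x, P x ∂(μ : Measure Ω) := by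
  refine (LipschitzWith.of_dist_le_mul (K := 1) fun P Q => ?_).continuous
  rw [dist_eq_norm, dist_eq_norm, ← integral_sub (P.continuous.integrable_probabilityMeasure μ)
    (Q.continuous.integrable_probabilityMeasure μ)]
  simpa using norm_integral_le_of_norm_le_const (μ := (μ : Measure Ω))
    (Eventually.of_forall fun x => (P - Q).norm_coe_le_norm x)

/-- If the objective is Lipschitz in the moments, the dual problem has a solution. -/
theorem exists_dualOptimal {m : Ω → E} (hm : Continuous m) {L : ℝ≥0}
    {V : ProbabilityMeasure Ω → ℝ} (hV : Continuous V)
    (hL : ∀ μ ν : ProbabilityMeasure Ω,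
      V μ ≤ V ν + L * ‖∫ x, m x ∂(μ : Measure Ω) - ∫ x, m x ∂(ν : Measure Ω)‖)
    (μ₀ : ProbabilityMeasure Ω) : ∃ P : C(Ω, ℝ), DualOptimal V μ₀ P := by
  set c : ℝ := ‖ContinuousMap.mk V hV‖
  have hVc : ∀ μ, |V μ| ≤ c := (ContinuousMap.mk V hV).norm_coe_le_norm
  set d : ℝ := 2 * ‖ContinuousMap.mk m hm‖
  have hmd : ∀ x y, ‖m x - m y‖ ≤ d := fun x y => by
    have h1 := (ContinuousMap.mk m hm).norm_coe_le_norm x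
    have h2 := (ContinuousMap.mk m hm).norm_coe_le_norm y
    have h3 := norm_sub_le (m x) (m y)
    simp only [ContinuousMap.coe_mk] at h1 h2
    linarith
  have hcont : ∀ μ : ProbabilityMeasure Ω,
      Continuous fun P : C(Ω, ℝ) => ∫ x, P x ∂(μ : Measure Ω) := fun μ =>
    continuous_integral_continuousMap_left μ
  -- The cap `c` on the value loses nothing, since the constant price `c` is feasible and attains
  -- it.
  let K : Set C(Ω, ℝ) := {P | DualFeasible V P ∧ (∀ x y, P x ≤ P y + L * ‖m x - m y‖) ∧
    ∫ x, P x ∂(μ₀ : Measure Ω) ≤ c}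
  have hKclosed : IsClosed K := by
    refine IsClosed.inter ?_ (IsClosed.inter ?_ (isClosed_le (hcont μ₀) continuous_const))
    · have : {P : C(Ω, ℝ) | DualFeasible V P} =
          ⋂ μ : ProbabilityMeasure Ω, {P | V μ ≤ ∫ x, P x ∂(μ : Measure Ω)} := by
        ext P; simp [DualFeasible]
      change IsClosed {P : C(Ω, ℝ) | DualFeasible V P}
      rw [this]
      exact isClosed_iInter fun μ => isClosed_le continuous_const (hcont μ)
    · have : {P : C(Ω, ℝ) | ∀ x y, P x ≤ P y + L * ‖m x - m y‖} =
          ⋂ x, ⋂ y, {P | P x ≤ P y + L * ‖m x - m y‖} := by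
        ext P; simp
      change IsClosed {P : C(Ω, ℝ) | ∀ x y, P x ≤ P y + L * ‖m x - m y‖}
      rw [this]
      exact isClosed_iInter fun x => isClosed_iInter fun y => isClosed_le
        (continuous_eval_const x)
        ((continuous_eval_const y).add continuous_const)
  have hKbdd : ∀ P ∈ K, ∀ x, |P x| ≤ c + L * d := by
    rintro P ⟨hP, hlip, hle⟩ x
    have hLd : 0 ≤ (L : ℝ) * d := by positivity
    rw [abs_le]
    -- Below, test feasibility at the point mass at `x`. Above, the mean of `P` is at most `c` and
    -- its oscillation at most `L * d`.
    constructor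
    · have h1 := hP (diracProba x)
      change _ ≤ ∫ y, P y ∂(Measure.dirac x) at h1
      rw [integral_dirac] at h1
      have := (abs_le.1 (hVc (diracProba x))).1
      linarith
    · have h1 : ∫ y, (P x - L * d) ∂(μ₀ : Measure Ω) ≤ ∫ y, P y ∂(μ₀ : Measure Ω) := by
        refine integral_mono (integrable_const _)
          (P.continuous.integrable_probabilityMeasure μ₀) fun y => ?_
        have h2 := hlip x y
        have h3 := mul_le_mul_of_nonneg_left (hmd x y) L.coe_nonneg
        simp only
        linarith
      simp only [integral_const, probReal_univ, one_smul] at h1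
      linarith
  have hKcompact := isCompact_of_lipschitz_along hm L _ hKclosed (fun P hP => hP.2.1) hKbdd
  have hKne : K.Nonempty := ⟨ContinuousMap.const Ω c,
    dualFeasible_const fun μ => (le_abs_self _).trans (hVc μ),
    fun x y => by simpa using by positivity, by simp⟩
  obtain ⟨P, hPK, hmin⟩ := hKcompact.exists_isMinOn hKne (hcont μ₀).continuousOn
  refine ⟨P, hPK.1, fun Q hQ => ?_⟩
  obtain ⟨R, hRQ, hRlip, hRatt⟩ := exists_lipschitzEnvelope hm L Q
  have hRfeas := dualFeasible_of_envelope hm hV hL hQ hRatt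
  have hRle : ∫ x, R x ∂(μ₀ : Measure Ω) ≤ ∫ x, Q x ∂(μ₀ : Measure Ω) :=
    integral_mono (R.continuous.integrable_probabilityMeasure μ₀)
      (Q.continuous.integrable_probabilityMeasure μ₀) hRQ
  -- An envelope above the cap lies outside `K`, but then costs more than `P` anyway.
  by_cases hRc : ∫ x, R x ∂(μ₀ : Measure Ω) ≤ c
  · exact (hmin ⟨hRfeas, hRlip, hRc⟩ : _ ≤ _).trans hRle
  · exact hPK.2.2.trans ((not_le.1 hRc).le.trans hRle)

end Attainment

/-- In finite dimension, the convex hull of a compact set is compact. -/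
theorem isCompact_convexHull {E : Type*} [NormedAddCommGroup E] [NormedSpace ℝ E]
    [FiniteDimensional ℝ E] {s : Set E} (hs : IsCompact s) : IsCompact (convexHull ℝ s) := by
  let J := Fin (Module.finrank ℝ E + 1)
  have himg : convexHull ℝ s = (fun p : (J → ℝ) × (J → E) => ∑ j, p.1 j • p.2 j) ''
      (stdSimplex ℝ J ×ˢ Set.univ.pi fun _ => s) := by
    refine Set.Subset.antisymm (fun x hx => ?_) ?_
    -- Carathéodory: affinely independent points number at most `finrank + 1`, so they can be
    -- indexed inside `J`.
    · obtain ⟨ι, _, z, w, hz, hind, hw, hsum, hx⟩ := eq_pos_convex_span_of_mem_convexHull hx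
      have hcard : Fintype.card ι ≤ Fintype.card J := by
        simpa [J] using hind.card_le_finrank_succ.trans
          (Nat.add_le_add_right (Submodule.finrank_le _) 1)
      obtain ⟨e⟩ := Function.Embedding.nonempty_of_card_le hcard
      have hne : Nonempty ι := by
        by_contra h
        rw [not_nonempty_iff] at h
        simp at hsum
      obtain ⟨i₀⟩ := hne
      -- Unused indices get weight `0`; their point `z i₀` only has to lie in `s`.
      refine ⟨(Function.extend e w 0, Function.extend e z fun _ => z i₀), ⟨⟨fun j => ?_, ?_⟩,
        fun j _ => ?_⟩, ?_⟩
      · by_cases h : ∃ i, e i = j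
        · obtain ⟨i, rfl⟩ := h
          simpa only [e.injective.extend_apply] using (hw i).le
        · simp [Function.extend_apply' _ _ _ h]
      · rw [← hsum]
        refine (Fintype.sum_of_injective e e.injective _ _ (fun j h => ?_) fun i => ?_).symm
        · exact Function.extend_apply' _ _ _ h
        · exact (e.injective.extend_apply _ _ _).symm
      · by_cases h : ∃ i, e i = j
        · obtain ⟨i, rfl⟩ := h
          simpa only [e.injective.extend_apply] using hz ⟨i, rfl⟩
        · simpa only [Function.extend_apply' _ _ _ h] using hz ⟨i₀, rfl⟩
      · rw [← hx]
        refine (Fintype.sum_of_injective e e.injective _ _ (fun j h => ?_) fun i => ?_).symm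
        · have : Function.extend e w 0 j = 0 := Function.extend_apply' _ _ _ h
          simp only [this, zero_smul]
        · simp only [e.injective.extend_apply]
    · rintro _ ⟨⟨w, z⟩, ⟨hw, hz⟩, rfl⟩
      exact (convex_convexHull ℝ s).sum_mem (fun j _ => hw.1 j) hw.2
        fun j _ => subset_convexHull ℝ s (hz j trivial)
  rw [himg]
  exact ((isCompact_stdSimplex ℝ J).prod (isCompact_univ_pi fun _ => hs)).image (by fun_prop)

/-! ### Moment persuasion and the product objective -/

section Moments

variable {Ω : Type*} [MetricSpace Ω] [CompactSpace Ω] [MeasurableSpace Ω] [BorelSpace Ω]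

theorem integral_mem_momentSpace {N : ℕ} {m : Ω → EuclideanSpace ℝ (Fin N)} (hm : Continuous m)
    (μ : ProbabilityMeasure Ω) : ∫ x, m x ∂(μ : Measure Ω) ∈ momentSpace m :=
  (convex_convexHull ℝ _).integral_mem (isCompact_convexHull (isCompact_range hm)).isClosed
    (Eventually.of_forall fun x => subset_convexHull ℝ _ ⟨x, rfl⟩)
    (hm.integrable_probabilityMeasure μ)

theorem regular_and_strongDuality_of_lipschitzOnWith {N : ℕ} {m : Ω → EuclideanSpace ℝ (Fin N)}
    {v : EuclideanSpace ℝ (Fin N) → ℝ} (hm : Continuous m) {L : ℝ≥0}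
    (hv : LipschitzOnWith L v (momentSpace m)) (μ₀ : ProbabilityMeasure Ω) :
    Regular (momentObjective m v) μ₀ ∧ StrongDuality (momentObjective m v) μ₀ := by
  -- Off the moment space `v` is arbitrary; a globally Lipschitz extension makes the composition
  -- continuous and measurable.
  obtain ⟨w, hw, hvw⟩ := hv.extend_real
  have hobj : momentObjective m v = fun μ : ProbabilityMeasure Ω => w (∫ x, m x ∂(μ : Measure Ω)) :=
    funext fun μ => hvw (integral_mem_momentSpace hm μ)
  have hcont : Continuous (momentObjective m v) :=
    by rw [hobj]; exact hw.continuous.comp (continuous_integral_euclidean hm)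
  have hmeas : Measurable (momentObjective m v) :=
    by rw [hobj]; exact hw.continuous.measurable.comp (measurable_integral_probabilityMeasure hm)
  obtain ⟨P, hP⟩ := exists_dualOptimal hm hcont (L := L) (fun μ ν => by
    have := hw.dist_le_mul (∫ x, m x ∂(μ : Measure Ω)) (∫ x, m x ∂(ν : Measure Ω))
    rw [Real.dist_eq, dist_eq_norm] at this
    have h2 := (abs_le.1 this).2
    simp only [hobj]
    linarith) μ₀
  exact ⟨regular_of_dualOptimal hP, strongDuality_of_dualOptimal hcont hmeas hP⟩

theorem lipschitzOnWith_mul_of_isCompact {s : Set (EuclideanSpace ℝ (Fin 2))} (hs : IsCompact s) :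
    ∃ L : ℝ≥0, LipschitzOnWith L (fun x : EuclideanSpace ℝ (Fin 2) => x 0 * x 1) s := by
  obtain ⟨C, hC⟩ := hs.isBounded.exists_norm_le
  -- One `C` for each factor of the product. `toNNReal` is needed as `C` may be negative when `s` is
  -- empty.
  refine ⟨(2 * C).toNNReal, LipschitzOnWith.of_dist_le_mul fun x hx y hy => ?_⟩
  have hx0 := (PiLp.norm_apply_le x 0).trans (hC x hx)
  have hy1 := (PiLp.norm_apply_le y 1).trans (hC y hy)
  have hC0 : 0 ≤ C := (norm_nonneg _).trans hx0
  have h0 := PiLp.norm_apply_le (x - y) 0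
  have h1 := PiLp.norm_apply_le (x - y) 1
  rw [Real.dist_eq, dist_eq_norm, Real.coe_toNNReal _ (by positivity)]
  simp only [PiLp.sub_apply, Real.norm_eq_abs] at *
  calc |x 0 * x 1 - y 0 * y 1| = |x 0 * (x 1 - y 1) + (x 0 - y 0) * y 1| := by ring_nf
    _ ≤ |x 0| * |x 1 - y 1| + |x 0 - y 0| * |y 1| := by
        simpa only [abs_mul] using abs_add_le (x 0 * (x 1 - y 1)) ((x 0 - y 0) * y 1)
    _ ≤ C * ‖x - y‖ + ‖x - y‖ * C := by gcongr
    _ = 2 * C * ‖x - y‖ := by ring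

end Moments
end Persuasion

theorem mainTheorem9 {Ω : Type*} [MetricSpace Ω] [CompactSpace Ω] [MeasurableSpace Ω]
    [BorelSpace Ω] (μ₀ : ProbabilityMeasure Ω)
    (hμ₀ : (μ₀ : Measure Ω).IsOpenPosMeasure) :
    (∀ (N : ℕ) (m : Ω → EuclideanSpace ℝ (Fin N)) (v : EuclideanSpace ℝ (Fin N) → ℝ),
      Continuous m →
      (∃ L : ℝ≥0, LipschitzOnWith L v (Persuasion.momentSpace m)) →
      Persuasion.Regular (Persuasion.momentObjective m v) μ₀ ∧
        Persuasion.StrongDuality (Persuasion.momentObjective m v) μ₀) ∧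
    (∀ m : Ω → EuclideanSpace ℝ (Fin 2), Continuous m →
      Persuasion.Regular (Persuasion.momentObjective m (fun x => x 0 * x 1)) μ₀ ∧
        Persuasion.StrongDuality (Persuasion.momentObjective m (fun x => x 0 * x 1)) μ₀) := by
  refine ⟨fun N m v hm ⟨L, hv⟩ =>
    Persuasion.regular_and_strongDuality_of_lipschitzOnWith hm hv μ₀, fun m hm => ?_⟩
  obtain ⟨L, hL⟩ := Persuasion.lipschitzOnWith_mul_of_isCompact
    (Persuasion.isCompact_convexHull (isCompact_range hm))
  exact Persuasion.regular_and_strongDuality_of_lipschitzOnWith hm hL μ₀
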